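/- Let $n\ge 1$, and let $MA(n,\mathbb{C})$ be the set of all affine maps $x\mapsto Ax+a$ of $\mathbb{C}^n$ to itself, where $A$ is an $n\times n$ complex matrix (not necessarily invertible) and $a\in\mathbb{C}^n$; it is a semigroup under composition. Let $\mathcal{G}$ be an abelian subsemigroup of $MA(n,\mathbb{C})$ generated by $p$ affine maps, for some $p\ge 1$. Then for every integer $k\ge 2$ the action of $\mathcal{G}$ on $\mathbb{C}^n$ is not $k$-transitive; that is, there is no $u=(x_1,\dots,x_k)\in(\mathbb{C}^n)^k$ whose orbit $$\{(g(x_1),\dots,g(x_k)) : g\in\mathcal{G}\}$$ is dense in $(\mathbb{C}^n)^k$. -/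

import Mathlib

/-- `MA(n, ℂ)`: the affine maps `x ↦ A x + a` of `ℂⁿ` to itself, not necessarily invertible.
Its multiplication is composition of maps. -/
abbrev MA (n : ℕ) : Type := (Fin n → ℂ) →ᵃ[ℂ] (Fin n → ℂ)

/-- The orbit `{(g(x₁), …, g(x_k)) : g ∈ 𝒢}` of `u = (x₁, …, x_k)` under the diagonal action of
a semigroup `𝒢` of affine maps on `(ℂⁿ)ᵏ`. -/
def affineOrbit {n : ℕ} (𝒢 : Subsemigroup (MA n)) (k : ℕ) (u : Fin k → Fin n → ℂ) :
    Set (Fin k → Fin n → ℂ) :=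
  {v | ∃ g ∈ 𝒢, v = fun j => g (u j)}

/-- The action of `𝒢` on `ℂⁿ` is `k`-transitive: the induced action on `(ℂⁿ)ᵏ` is hypercyclic,
that is, it has a dense orbit. -/
def IsKTransitive {n : ℕ} (𝒢 : Subsemigroup (MA n)) (k : ℕ) : Prop :=
  ∃ u : Fin k → Fin n → ℂ, closure (affineOrbit 𝒢 k u) = Set.univ

/-! A dense orbit makes `u j - u i` have dense orbit under the commuting linear parts. Some linear
part then lacks eigenvalue 1, so its map has a unique fixed point `c`, which commutativity makes
common to `𝒢`. Centred at `c` the action is linear and `u i - c` has dense orbit, so `u j - c = P (u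
i - c)` with `P` in the commutant. The orbit thus stays in the graph of `P`, a proper closed set. -/

/-- Two endomorphisms commuting with a set `T` agree as soon as they agree at a vector whose
`T`-orbit is dense. -/
theorem eq_of_commute_of_dense_orbit {n : ℕ} {T : Set (Module.End ℂ (Fin n → ℂ))}
    {y : Fin n → ℂ} (hy : Dense ((fun t : Module.End ℂ (Fin n → ℂ) => t y) '' T))
    {r s : Module.End ℂ (Fin n → ℂ)} (hr : ∀ t ∈ T, r * t = t * r) (hs : ∀ t ∈ T, s * t = t * s)
    (h : r y = s y) : r = s := by
  refine DFunLike.coe_injective (Continuous.ext_on hy r.continuous_of_finiteDimensional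
    s.continuous_of_finiteDimensional ?_)
  rintro _ ⟨t, ht, rfl⟩
  have h1 := LinearMap.congr_fun (hr t ht) y
  have h2 := LinearMap.congr_fun (hs t ht) y
  simp only [Module.End.mul_apply] at h1 h2 ⊢
  rw [h1, h2, h]

/-- If a commuting set `T` of endomorphisms has a vector `y` with dense orbit, then evaluation at
`y` has a linear section with values in the commutant of `T`. -/
theorem exists_section_commutant {n : ℕ} {T : Set (Module.End ℂ (Fin n → ℂ))}
    (hT : ∀ s ∈ T, ∀ t ∈ T, s * t = t * s)
    {y : Fin n → ℂ} (hy : Dense ((fun t : Module.End ℂ (Fin n → ℂ) => t y) '' T)) :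
    ∃ φ : (Fin n → ℂ) →ₗ[ℂ] Module.End ℂ (Fin n → ℂ),
      (∀ v, φ v y = v) ∧ ∀ v, ∀ t ∈ T, φ v * t = t * φ v := by
  let R := Submodule.span ℂ T
  let ev : R →ₗ[ℂ] (Fin n → ℂ) := (LinearMap.applyₗ y).comp R.subtype
  have hev : LinearMap.range ev = ⊤ := by
    have hcl : IsClosed (LinearMap.range ev : Set (Fin n → ℂ)) :=
      Submodule.closed_of_finiteDimensional _
    have hd : Dense (LinearMap.range ev : Set (Fin n → ℂ)) := by
      refine hy.mono ?_
      rintro _ ⟨t, ht, rfl⟩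
      exact ⟨⟨t, Submodule.subset_span ht⟩, rfl⟩
    exact SetLike.coe_injective (hcl.closure_eq.symm.trans hd.closure_eq)
  obtain ⟨ψ, hψ⟩ := ev.exists_rightInverse_of_surjective hev
  refine ⟨R.subtype.comp ψ, fun v => LinearMap.congr_fun hψ v, fun v t ht => ?_⟩
  have key : ∀ r ∈ R, r * t = t * r := by
    intro r hr
    induction hr using Submodule.span_induction with
    | mem s hs => exact hT s hs t ht
    | zero => simp
    | add a b _ _ ha hb => rw [add_mul, mul_add, ha, hb]
    | smul c a _ ha => rw [smul_mul_assoc, mul_smul_comm, ha]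
  exact key _ (ψ v).2

/-- A commuting set of endomorphisms with a dense orbit contains an element for which `1` is not
an eigenvalue. -/
theorem exists_isUnit_sub_one {n : ℕ} {T : Set (Module.End ℂ (Fin n → ℂ))}
    (hT : ∀ s ∈ T, ∀ t ∈ T, s * t = t * s)
    {y : Fin n → ℂ} (hy : Dense ((fun t : Module.End ℂ (Fin n → ℂ) => t y) '' T)) :
    ∃ t ∈ T, IsUnit (t - 1) := by
  obtain ⟨φ, hφy, hφT⟩ := exists_section_commutant hT hy
  let M : (Fin n → ℂ) →ₗ[ℂ] Matrix (Fin n) (Fin n) ℂ := LinearMap.toMatrix'.toLinearMap.comp φ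
  have hM : Continuous M := M.continuous_of_finiteDimensional
  have hcont : Continuous fun v => (M v - 1).det := (hM.sub continuous_const).matrix_det
  have hdet : ∀ v, (M v - 1).det = LinearMap.det (φ v - 1) := by
    intro v
    rw [← LinearMap.det_toMatrix', map_sub, LinearMap.toMatrix'_one]
    rfl
  -- At `2y` the determinant is `det (2 - 1) = 1`, so its nonvanishing locus is nonempty and open,
  -- hence meets the orbit.
  have htwo : φ ((2 : ℂ) • y) = (2 : ℂ) • 1 :=
    eq_of_commute_of_dense_orbit hy (hφT _) (fun t _ => by simp) (by simp [hφy])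
  have hne : ((fun v => (M v - 1).det) ⁻¹' {0}ᶜ).Nonempty := by
    refine ⟨(2 : ℂ) • y, ?_⟩
    have h1 : ((2 : ℂ) • 1 - 1 : Module.End ℂ (Fin n → ℂ)) = 1 := by
      rw [two_smul, add_sub_cancel_right]
    simp only [Set.mem_preimage, Set.mem_compl_iff, Set.mem_singleton_iff]
    rw [hdet, htwo, h1]
    simp
  obtain ⟨_, hv, t, ht, rfl⟩ := hy.inter_open_nonempty _
    (isOpen_compl_singleton.preimage hcont) hne
  refine ⟨t, ht, ?_⟩
  have heq : φ (t y) = t :=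
    eq_of_commute_of_dense_orbit hy (hφT _) (fun s hs => hT t ht s hs) (hφy _)
  simp only [Set.mem_preimage, Set.mem_compl_iff, Set.mem_singleton_iff] at hv
  rw [hdet, heq] at hv
  exact (LinearMap.isUnit_iff_isUnit_det _).2 (isUnit_iff_ne_zero.2 hv)

/-- If an affine map `g` has a linear part without eigenvalue `1`, then some point is fixed by
every affine map commuting with `g`. -/
theorem exists_common_fixed_point {n : ℕ} {g : MA n} (hg : IsUnit (g.linear - 1)) :
    ∃ c, ∀ h : MA n, g * h = h * g → h c = c := by
  have hbij := (Module.End.isUnit_iff _).1 hg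
  have hdec : ∀ x, g x = g.linear x + g 0 := fun x => congrFun g.decomp x
  obtain ⟨c, hc⟩ := hbij.2 (-g 0)
  have hlin : ∀ x, (g.linear - 1) x = g x - g 0 - x := by
    intro x
    rw [hdec x]
    simp
  have hgc : g c = c := by
    rw [hlin] at hc
    linear_combination (exp := 1) hc
  -- `h c` is also fixed by `g`, whose fixed point is unique.
  refine ⟨c, fun h hh => hbij.1 ?_⟩
  have hghc : g (h c) = h c := by
    have := congrArg (fun k : MA n => k c) hh
    simpa [hgc] using this
  rw [hlin, hlin, hghc, hgc]
  simp

theorem theorem1p2 (n : ℕ) (hn : 1 ≤ n) (p : ℕ) (hp : 1 ≤ p) (f : Fin p → MA n)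
    (𝒢 : Subsemigroup (MA n)) (hgen : 𝒢 = Subsemigroup.closure (Set.range f))
    (hab : ∀ g ∈ 𝒢, ∀ h ∈ 𝒢, g * h = h * g) (k : ℕ) (hk : 2 ≤ k) :
    ¬ IsKTransitive 𝒢 k := by
  rintro ⟨u, hu⟩
  have hd : Dense (affineOrbit 𝒢 k u) := dense_iff_closure_eq.2 hu
  let i : Fin k := ⟨0, by omega⟩
  let j : Fin k := ⟨1, by omega⟩
  have hij : j ≠ i := by simp [i, j]
  let T : Set (Module.End ℂ (Fin n → ℂ)) := (fun g : MA n => g.linear) '' 𝒢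
  have hT : ∀ s ∈ T, ∀ t ∈ T, s * t = t * s := by
    rintro _ ⟨g, hg, rfl⟩ _ ⟨h, hh, rfl⟩
    exact congrArg AffineMap.linear (hab g hg h hh)
  have hdense : ∀ (F : (Fin k → Fin n → ℂ) → Fin n → ℂ) (y : Fin n → ℂ), Continuous F →
      Function.Surjective F → (∀ g ∈ 𝒢, F (fun l => g (u l)) = g.linear y) →
      Dense ((fun t : Module.End ℂ (Fin n → ℂ) => t y) '' T) := by
    intro F y hF hs hFy
    refine (hs.denseRange.dense_image hF hd).mono ?_
    rintro _ ⟨_, ⟨g, hg, rfl⟩, rfl⟩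
    exact ⟨g.linear, ⟨g, hg, rfl⟩, (hFy g hg).symm⟩
  have hdiff : Dense ((fun t : Module.End ℂ (Fin n → ℂ) => t (u j - u i)) '' T) := by
    refine hdense (fun v => v j - v i) _ (by fun_prop) (fun w => ⟨Pi.single j w, ?_⟩) ?_
    · simp [hij.symm]
    · intro g _
      exact (g.linearMap_vsub (u j) (u i)).symm
  obtain ⟨_, ⟨g, hg, rfl⟩, hgu⟩ := exists_isUnit_sub_one hT hdiff
  obtain ⟨c, hc⟩ := exists_common_fixed_point hgu
  have hfix : ∀ h ∈ 𝒢, ∀ x, h x - c = h.linear (x - c) := by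
    intro h hh x
    conv_lhs => rw [← hc h (hab g hg h hh)]
    exact (h.linearMap_vsub x c).symm
  have hcyc : Dense ((fun t : Module.End ℂ (Fin n → ℂ) => t (u i - c)) '' T) := by
    refine hdense (fun v => v i - c) _ (by fun_prop) (fun w => ⟨fun _ => w + c, ?_⟩) ?_
    · simp
    · exact fun h hh => hfix h hh (u i)
  obtain ⟨φ, hφy, hφT⟩ := exists_section_commutant hT hcyc
  let P := φ (u j - c)
  have hP : Continuous P := P.continuous_of_finiteDimensional
  have hgraph : IsClosed {v : Fin k → Fin n → ℂ | v j - c = P (v i - c)} :=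
    isClosed_eq (by fun_prop) (hP.comp (by fun_prop))
  have hsub : affineOrbit 𝒢 k u ⊆ {v | v j - c = P (v i - c)} := by
    rintro _ ⟨h, hh, rfl⟩
    have hcomm := LinearMap.congr_fun (hφT (u j - c) h.linear ⟨h, hh, rfl⟩) (u i - c)
    simp only [Module.End.mul_apply, hφy] at hcomm
    simp only [Set.mem_ofPred_eq]
    rw [hfix h hh, hfix h hh, ← hcomm]
  have hall : ∀ v : Fin k → Fin n → ℂ, v j - c = P (v i - c) := fun v =>
    hgraph.closure_subset_iff.2 hsub (hu ▸ Set.mem_univ v)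
  -- A point off the graph: `P 0 = 0`, while the all-ones vector is nonzero as `n ≥ 1`.
  have h1 := hall (Function.update (fun _ => c) j (c + 1))
  simp only [Function.update_self, Function.update_of_ne hij.symm, sub_self, map_zero,
    add_sub_cancel_left] at h1
  exact one_ne_zero (congrFun h1 ⟨0, hn⟩)
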